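/- Theorem 4.8. Let $\mathbb K=\mathbb R$ or $\mathbb C$ and let $E$ be a Banach space over $\mathbb K$ with a finite-dimensional decomposition with associated projections $\{\pi_m\}_{m\ge 0}$; that is, $\pi_0=0$, each $\pi_m$ is a bounded linear operator on $E$ of finite rank, $\pi_m\pi_k=\pi_{\min(m,k)}$ for all $m,k$, and $\pi_m x\to x$ for every $x\in E$. Suppose that the decomposition is - 1-unconditional: for all $x\in E$ and all signs $\theta_j\in\{-1,1\}$, the series $\sum_{j\ge 1}\theta_j(\pi_j-\pi_{j-1})x$ converges unconditionally and its sum has norm at most $\|x\|$; - shrinking: $\|\gamma\circ\pi_m-\gamma\|\to 0$ for every $\gamma\in E^*$. Suppose also that $E$ has property (M): whenever $u,v\in E$ satisfy $\|u\|\le\|v\|$ and $(x_\alpha)$ is a bounded weakly null net in $E$, then $\limsup_\alpha\|u+x_\alpha\|\le\limsup_\alpha\|v+x_\alpha\|$. Let $J=\{m_j\}_{j\ge 1}$ be any strictly increasing sequence of positive integers, and put $m_0=0$ and $\sigma_j=\pi_{m_j}-\pi_{m_{j-1}}$ for $j\ge 1$. For an integer $n\ge 0$ let $\mathcal P({}^nE)$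 be the space of continuous $n$-homogeneous polynomials $P:E\to\mathbb K$ with the norm $\|P\|=\sup_{\|x\|\le 1}|P(x)|$, let $$\mathcal D_J({}^nE)=\Big\{P\in\mathcal P({}^nE): P(x)=\sum_{j=1}^\infty P(\sigma_j x)\ \text{ for all } x\in E\Big\},$$ and let $\mathcal D_{J,w}({}^nE)$ be the subspace of those $P\in\mathcal D_J({}^nE)$ whose restriction to every bounded subset of $E$ is weakly continuous. Then, for every $n$, $\mathcal D_{J,w}({}^nE)$ is an M-ideal in $X=\mathcal D_J({}^nE)$; that is, $\mathcal D_{J,w}({}^nE)$ is a closed subspace of $X$, and there is a closed subspace $F$ of $X^*$ such that $X^*$ is the direct sum of the annihilator $\mathcal D_{J,w}({}^nE)^{\perp}\subset X^*$ and $F$, with $\|f+g\|=\|f\|+\|g\|$ for all $f\in\mathcal D_{J,w}({}^nE)^{\perp}$ and $g\in F$. -/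

import Mathlib

open Filter Topology

noncomputable section

namespace PolyMIdeal

/-- `P(ⁿE)`: the continuous `n`-homogeneous polynomials `P : E → 𝕜`, i.e. the functions of the form
`P x = A (x, …, x)` with `A` a continuous `n`-linear form. (A `def`, so that it does not inherit the
topology of pointwise convergence from the function space.) -/
def HomPoly (𝕜 : Type*) [RCLike 𝕜] (E : Type*) [NormedAddCommGroup E] [NormedSpace 𝕜 E] (n : ℕ) :
    Type _ :=
  {P : E → 𝕜 // ∃ A : ContinuousMultilinearMap 𝕜 (fun _ : Fin n => E) 𝕜,
    ∀ x, P x = A (fun _ => x)}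

namespace HomPoly

variable {𝕜 : Type*} [RCLike 𝕜] {E : Type*} [NormedAddCommGroup E] [NormedSpace 𝕜 E] {n : ℕ}

instance : CoeFun (HomPoly 𝕜 E n) (fun _ => E → 𝕜) := ⟨Subtype.val⟩

theorem ext {P Q : HomPoly 𝕜 E n} (h : ∀ x, P x = Q x) : P = Q := Subtype.ext (funext h)

instance : Zero (HomPoly 𝕜 E n) := ⟨⟨fun _ => 0, 0, fun _ => rfl⟩⟩

instance : Add (HomPoly 𝕜 E n) :=
  ⟨fun P Q => ⟨fun x => P x + Q x, by
    obtain ⟨A, hA⟩ := P.2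
    obtain ⟨B, hB⟩ := Q.2
    exact ⟨A + B, fun x => by simp [hA, hB]⟩⟩⟩

instance : Neg (HomPoly 𝕜 E n) :=
  ⟨fun P => ⟨fun x => -P x, by
    obtain ⟨A, hA⟩ := P.2
    exact ⟨-A, fun x => by simp [hA]⟩⟩⟩

instance : Sub (HomPoly 𝕜 E n) :=
  ⟨fun P Q => ⟨fun x => P x - Q x, by
    obtain ⟨A, hA⟩ := P.2
    obtain ⟨B, hB⟩ := Q.2
    exact ⟨A - B, fun x => by simp [hA, hB]⟩⟩⟩

instance {R : Type*} [Monoid R] [DistribMulAction R 𝕜] [SMulCommClass 𝕜 R 𝕜]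
    [ContinuousConstSMul R 𝕜] : SMul R (HomPoly 𝕜 E n) :=
  ⟨fun c P => ⟨fun x => c • P x, by
    obtain ⟨A, hA⟩ := P.2
    exact ⟨c • A, fun x => by simp [hA]⟩⟩⟩

instance : AddCommGroup (HomPoly 𝕜 E n) :=
  Function.Injective.addCommGroup (fun (P : HomPoly 𝕜 E n) (x : E) => P x)
    Subtype.val_injective rfl (fun _ _ => rfl) (fun _ => rfl) (fun _ _ => rfl)
    (fun _ _ => rfl) (fun _ _ => rfl)

@[simp] theorem zero_apply (x : E) : (0 : HomPoly 𝕜 E n) x = 0 := rfl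
@[simp] theorem add_apply (P Q : HomPoly 𝕜 E n) (x : E) : (P + Q) x = P x + Q x := rfl
@[simp] theorem neg_apply (P : HomPoly 𝕜 E n) (x : E) : (-P) x = -P x := rfl
@[simp] theorem sub_apply (P Q : HomPoly 𝕜 E n) (x : E) : (P - Q) x = P x - Q x := rfl
@[simp] theorem smul_apply (c : 𝕜) (P : HomPoly 𝕜 E n) (x : E) : (c • P) x = c * P x := rfl

instance : Module 𝕜 (HomPoly 𝕜 E n) :=
  Function.Injective.module 𝕜
    { toFun := fun (P : HomPoly 𝕜 E n) (x : E) => P x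
      map_zero' := rfl
      map_add' := fun _ _ => rfl }
    Subtype.val_injective (fun _ _ => rfl)

theorem map_smul (P : HomPoly 𝕜 E n) (c : 𝕜) (x : E) : P (c • x) = c ^ n * P x := by
  obtain ⟨A, hA⟩ := P.2
  rw [hA, hA]
  simpa using A.map_smul_univ (fun _ => c) (fun _ => x)

/-- The norm of a polynomial: `sup {|P x| : ‖x‖ ≤ 1}`. -/
def supNorm (P : HomPoly 𝕜 E n) : ℝ := ⨆ x : Metric.closedBall (0 : E) 1, ‖P x‖

theorem bddAbove (P : HomPoly 𝕜 E n) :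
    BddAbove (Set.range fun x : Metric.closedBall (0 : E) 1 => ‖P x‖) := by
  obtain ⟨A, hA⟩ := P.2
  refine ⟨‖A‖, ?_⟩
  rintro _ ⟨⟨x, hx⟩, rfl⟩
  have hx' : ‖x‖ ≤ 1 := by simpa using hx
  have h := A.le_opNorm (fun _ => x)
  simp only [Finset.prod_const, Finset.card_univ, Fintype.card_fin] at h
  calc ‖P x‖ = ‖A (fun _ => x)‖ := by rw [hA]
    _ ≤ ‖A‖ * ‖x‖ ^ n := h
    _ ≤ ‖A‖ * 1 := by
      gcongr
      exact pow_le_one₀ (norm_nonneg x) hx'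
    _ = ‖A‖ := mul_one _

theorem apply_le_supNorm (P : HomPoly 𝕜 E n) {x : E} (hx : ‖x‖ ≤ 1) : ‖P x‖ ≤ supNorm P :=
  le_ciSup P.bddAbove ⟨x, by simpa using hx⟩

theorem supNorm_le (P : HomPoly 𝕜 E n) {C : ℝ} (h : ∀ x : E, ‖x‖ ≤ 1 → ‖P x‖ ≤ C) :
    supNorm P ≤ C := by
  have : Nonempty (Metric.closedBall (0 : E) 1) := ⟨⟨0, by simp⟩⟩
  exact ciSup_le fun x => h x (mem_closedBall_zero_iff.1 x.2)

instance : NormedAddCommGroup (HomPoly 𝕜 E n) :=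
  AddGroupNorm.toNormedAddCommGroup
    { toFun := supNorm
      map_zero' := le_antisymm (supNorm_le _ fun x _ => by simp)
        (Real.iSup_nonneg fun _ => norm_nonneg _)
      add_le' := fun P Q => supNorm_le _ fun x hx =>
        (norm_add_le _ _).trans (add_le_add (P.apply_le_supNorm hx) (Q.apply_le_supNorm hx))
      neg' := fun P => by simp [supNorm]
      eq_zero_of_map_eq_zero' := fun P hP => by
        have h0 : ∀ x : E, ‖x‖ ≤ 1 → P x = 0 := fun x hx => by
          have h := P.apply_le_supNorm hx
          rw [hP] at h
          exact norm_le_zero_iff.1 h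
        refine ext fun x => ?_
        have hpos : (0 : ℝ) < ‖x‖ + 1 := by positivity
        have hc : ((‖x‖ + 1 : ℝ) : 𝕜) ≠ 0 := by exact_mod_cast hpos.ne'
        have hx : x = ((‖x‖ + 1 : ℝ) : 𝕜) • ((((‖x‖ + 1 : ℝ) : 𝕜))⁻¹ • x) := by
          rw [smul_smul, mul_inv_cancel₀ hc, one_smul]
        have hle : ‖(((‖x‖ + 1 : ℝ) : 𝕜))⁻¹ • x‖ ≤ 1 := by
          rw [norm_smul, norm_inv, RCLike.norm_ofReal, abs_of_pos hpos, inv_mul_le_iff₀ hpos]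
          linarith
        rw [hx, map_smul, h0 _ hle, mul_zero, zero_apply] }

theorem norm_def (P : HomPoly 𝕜 E n) : ‖P‖ = ⨆ x : Metric.closedBall (0 : E) 1, ‖P x‖ := rfl

instance : NormedSpace 𝕜 (HomPoly 𝕜 E n) where
  norm_smul_le c P := supNorm_le _ fun x hx => by
    rw [smul_apply, norm_mul]
    exact mul_le_mul_of_nonneg_left (P.apply_le_supNorm hx) (norm_nonneg c)

end HomPoly

section MIdeal

variable {𝕜 : Type*} [RCLike 𝕜] {X : Type*} [NormedAddCommGroup X] [NormedSpace 𝕜 X]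

/-- The annihilator `J^⊥ ⊆ X^*` of a subspace `J ⊆ X`. -/
def annihilator (J : Submodule 𝕜 X) : Submodule 𝕜 (StrongDual 𝕜 X) where
  carrier := {f | ∀ x ∈ J, f x = 0}
  zero_mem' := fun _ _ => rfl
  add_mem' := fun {f g} hf hg x hx => by simp [hf x hx, hg x hx]
  smul_mem' := fun c f hf x hx => by simp [hf x hx]

/-- `J` is an M-ideal in `X`: `J` is closed and `X^* = J^⊥ ⊕₁ J^♯` for some closed subspace `J^♯`
of `X^*`. -/
def IsMIdeal (J : Submodule 𝕜 X) : Prop :=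
  IsClosed (J : Set X) ∧
    ∃ Jsharp : Submodule 𝕜 (StrongDual 𝕜 X),
      IsClosed (Jsharp : Set (StrongDual 𝕜 X)) ∧
      IsCompl (annihilator J) Jsharp ∧
      ∀ f ∈ annihilator J, ∀ g ∈ Jsharp, ‖f + g‖ = ‖f‖ + ‖g‖

end MIdeal

section Space

variable {𝕜 : Type*} [RCLike 𝕜] {E : Type*} [NormedAddCommGroup E] [NormedSpace 𝕜 E]

/-- `π` is the sequence of projections associated with a finite-dimensional decomposition of `E`:
`π 0 = 0`, and `π m` is the projection onto the sum of the first `m` summands; the `j`-th summand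
(`j ≥ 0`) is the range of `π (j + 1) - π j`. -/
structure IsFDD (π : ℕ → E →L[𝕜] E) : Prop where
  zero : π 0 = 0
  finiteDimensional_range : ∀ m, FiniteDimensional 𝕜 (π m).range
  comp : ∀ m k, (π m).comp (π k) = π (min m k)
  tendsto : ∀ x, Tendsto (fun m => π m x) atTop (𝓝 x)

/-- The decomposition is 1-unconditional: for every `x = ∑ x_j` (`x_j` in the `j`-th summand) and
every choice of signs `θ_j = ±1`, the series `∑ θ_j x_j` converges unconditionally and
`‖∑ θ_j x_j‖ ≤ ‖x‖`. -/
def IsOneUnconditional (π : ℕ → E →L[𝕜] E) : Prop :=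
  ∀ (θ : ℕ → ℤˣ) (x : E), ∃ y : E,
    HasSum (fun j => ((θ j : ℤ) : 𝕜) • (π (j + 1) x - π j x)) y ∧ ‖y‖ ≤ ‖x‖

/-- The decomposition is shrinking: `γ ∘ π m → γ` in the norm of `E^*`, for every `γ ∈ E^*`. -/
def IsShrinking (π : ℕ → E →L[𝕜] E) : Prop :=
  ∀ γ : StrongDual 𝕜 E, Tendsto (fun m => γ.comp (π m)) atTop (𝓝 γ)

variable (𝕜 E) in
/-- Property (M): `limsup ‖u + x_α‖ ≤ limsup ‖v + x_α‖` whenever `‖u‖ ≤ ‖v‖` and `(x_α)` is a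
bounded weakly null net. Nets in `E` are replaced by the (proper) filters `F` that they generate
on `E`. -/
def PropertyM : Prop :=
  ∀ (u v : E), ‖u‖ ≤ ‖v‖ → ∀ F : Filter E, F.NeBot →
    (∃ C : ℝ, ∀ᶠ x in F, ‖x‖ ≤ C) →
    (∀ γ : StrongDual 𝕜 E, Tendsto (fun x => γ x) F (𝓝 0)) →
    limsup (fun x => ‖u + x‖) F ≤ limsup (fun x => ‖v + x‖) F

variable (𝕜 E) in
/-- `P_w(ⁿE)`: the polynomials whose restriction to every bounded set is weakly continuous. -/
def weaklyContinuous (n : ℕ) : Submodule 𝕜 (HomPoly 𝕜 E n) where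
  carrier := {P | ∀ B : Set E, Bornology.IsBounded B →
    ContinuousOn (fun z : WeakSpace 𝕜 E => P ((toWeakSpace 𝕜 E).symm z)) (toWeakSpace 𝕜 E '' B)}
  zero_mem' := fun _ _ => continuousOn_const
  add_mem' := fun hP hQ B hB => (hP B hB).add (hQ B hB)
  smul_mem' := fun c _ hP B hB => (hP B hB).const_smul c

/-- The block projections for the sequence `m 0 < m 1 < …`: the first one is `π (m 0)`, and the
later ones are `π (m (j + 1)) - π (m j)`. -/
def blockProj (π : ℕ → E →L[𝕜] E) (m : ℕ → ℕ) : ℕ → E →L[𝕜] E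
  | 0 => π (m 0)
  | j + 1 => π (m (j + 1)) - π (m j)

/-- `D_J(ⁿE)`: the `P` with `P x = ∑_j P (σ_j x)` for all `x`, where `σ_j` are the block
projections. -/
def blockDiagonal (π : ℕ → E →L[𝕜] E) (m : ℕ → ℕ) (n : ℕ) : Submodule 𝕜 (HomPoly 𝕜 E n) where
  carrier := {P | ∀ x, Tendsto (fun N => ∑ j ∈ Finset.range N, P (blockProj π m j x))
    atTop (𝓝 (P x))}
  zero_mem' := fun x => by simp
  add_mem' := fun {P Q} hP hQ x => by
    simpa [Finset.sum_add_distrib] using (hP x).add (hQ x)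
  smul_mem' := fun c P hP x => by
    simpa [Finset.mul_sum] using (hP x).const_mul c

/-- `D_{J,w}(ⁿE) = D_J(ⁿE) ∩ P_w(ⁿE)`. -/
def blockDiagonalW (π : ℕ → E →L[𝕜] E) (m : ℕ → ℕ) (n : ℕ) : Submodule 𝕜 (HomPoly 𝕜 E n) :=
  blockDiagonal π m n ⊓ weaklyContinuous 𝕜 E n

end Space

end PolyMIdeal

end

open PolyMIdeal

open Filter Topology

namespace PolyMIdeal

variable {𝕜 : Type*} [RCLike 𝕜]

section MIdeal

variable {X : Type*} [NormedAddCommGroup X] [NormedSpace 𝕜 X]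

/-- The functionals `g` with `g (T k x) → g x` along `U`, for all `x`. -/
def limitFunctionals (U : Filter ℕ) (T : ℕ → X →L[𝕜] X) : Submodule 𝕜 (StrongDual 𝕜 X) where
  carrier := {g | ∀ x, Tendsto (fun k => g (T k x)) U (𝓝 (g x))}
  zero_mem' := fun _ => tendsto_const_nhds
  add_mem' := fun hf hg x => (hf x).add (hg x)
  smul_mem' := fun c _ hf x => (hf x).const_mul c

theorem isClosed_limitFunctionals {U : Filter ℕ} {T : ℕ → X →L[𝕜] X}
    (hT : ∀ k x, ‖T k x‖ ≤ ‖x‖) :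
    IsClosed (limitFunctionals U T : Set (StrongDual 𝕜 X)) := by
  refine isClosed_of_closure_subset fun g hg x => ?_
  rw [Metric.tendsto_nhds]
  intro ε hε
  obtain ⟨f, hf, hfg⟩ := Metric.mem_closure_iff.1 hg (ε / (3 * (‖x‖ + 1))) (by positivity)
  have hb : ∀ y, ‖y‖ ≤ ‖x‖ → ‖g y - f y‖ < ε / 3 := fun y hy => by
    rw [dist_eq_norm] at hfg
    calc ‖g y - f y‖ = ‖(g - f) y‖ := by simp
      _ ≤ ‖g - f‖ * ‖y‖ := (g - f).le_opNorm y
      _ ≤ ‖g - f‖ * (‖x‖ + 1) := by gcongr; linarith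
      _ < ε / (3 * (‖x‖ + 1)) * (‖x‖ + 1) := by gcongr
      _ = ε / 3 := by field_simp
  filter_upwards [Metric.tendsto_nhds.1 (hf x) (ε / 3) (by positivity)] with k hk
  rw [dist_eq_norm] at hk ⊢
  have h1 := hb _ (hT k x)
  have h2 := hb x le_rfl
  calc ‖g (T k x) - g x‖
      = ‖(g (T k x) - f (T k x)) + (f (T k x) - f x) - (g x - f x)‖ := by congr 1; ring
    _ ≤ ‖g (T k x) - f (T k x)‖ + ‖f (T k x) - f x‖ + ‖g x - f x‖ :=
        (norm_sub_le _ _).trans (by gcongr; exact norm_add_le _ _)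
    _ < ε := by linarith

theorem exists_tendsto_of_bounded {ι : Type*} (U : Ultrafilter ι) {F : Type*}
    [PseudoMetricSpace F] [ProperSpace F] {f : ι → F} {y : F} {C : ℝ}
    (hf : ∀ᶠ k in U, dist (f k) y ≤ C) : ∃ z, Tendsto f U (𝓝 z) := by
  obtain ⟨z, -, hz⟩ := (isCompact_closedBall y C).ultrafilter_le_nhds (U.map f)
    (le_principal_iff.2 hf)
  exact ⟨z, hz⟩

theorem exists_limit_functional (U : Ultrafilter ℕ) {T : ℕ → X →L[𝕜] X}
    (hT : ∀ k x, ‖T k x‖ ≤ ‖x‖) (f : StrongDual 𝕜 X) :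
    ∃ g : StrongDual 𝕜 X, ∀ x, Tendsto (fun k => f (T k x)) U (𝓝 (g x)) := by
  have hb : ∀ k x, ‖f (T k x)‖ ≤ ‖f‖ * ‖x‖ := fun k x =>
    (f.le_opNorm _).trans (by gcongr; exact hT k x)
  have h : ∀ x, ∃ z, Tendsto (fun k => f (T k x)) U (𝓝 z) := fun x =>
    exists_tendsto_of_bounded U (y := 0) (C := ‖f‖ * ‖x‖)
      (Eventually.of_forall fun k => by simpa using hb k x)
  choose g hg using h
  refine ⟨LinearMap.mkContinuous
    { toFun := g
      map_add' := fun x y => tendsto_nhds_unique (hg (x + y)) (by simpa using (hg x).add (hg y))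
      map_smul' := fun c x =>
        tendsto_nhds_unique (hg (c • x)) (by simpa using (hg x).const_mul c) } ‖f‖
    fun x => le_of_tendsto (hg x).norm (Eventually.of_forall fun k => hb k x), hg⟩

theorem exists_norm_le_one_ofReal_eq (f : StrongDual 𝕜 X) {r : ℝ} (hr : r < ‖f‖) :
    ∃ x : X, ‖x‖ ≤ 1 ∧ ∃ s : ℝ, r < s ∧ f x = (s : 𝕜) := by
  rcases lt_or_ge r 0 with h0 | h0
  · exact ⟨0, by simp, 0, h0, by simp⟩
  obtain ⟨x, hx, hfx⟩ := f.exists_lt_apply_of_lt_opNorm hr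
  obtain ⟨c, hc, hcx⟩ := RCLike.exists_norm_eq_mul_self (f x)
  exact ⟨c • x, by rw [norm_smul, hc, one_mul]; exact hx.le, ‖f x‖, hfx, by simp [hcx]⟩

/-- A closed subspace `J` is an M-ideal if there are contractions `T k` with values in `J`,
converging pointwise to the identity on `J`, such that `‖T l x + (y - T k y)‖` is asymptotically at
most `1` for `x`, `y` in the unit ball. -/
theorem isMIdeal_of_contractions {J : Submodule 𝕜 X} (hJ : IsClosed (J : Set X))
    {T : ℕ → X →L[𝕜] X} (hT : ∀ k x, ‖T k x‖ ≤ ‖x‖) (hTJ : ∀ k x, T k x ∈ J)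
    (hlim : ∀ x ∈ J, Tendsto (fun k => T k x) atTop (𝓝 x))
    (hmax : ∀ x y, ‖x‖ ≤ 1 → ‖y‖ ≤ 1 → ∀ l, ∀ ε > 0,
      ∀ᶠ k in atTop, ‖T l x + (y - T k y)‖ ≤ 1 + ε) : IsMIdeal J := by
  let U : Ultrafilter ℕ := hyperfilter ℕ
  have hU : (U : Filter ℕ) ≤ atTop := by
    rw [← Nat.cofinite_eq_atTop]; exact hyperfilter_le_cofinite
  refine ⟨hJ, limitFunctionals U T, isClosed_limitFunctionals hT, ⟨?_, ?_⟩, ?_⟩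
  · rw [Submodule.disjoint_def]
    intro f hf hf'
    ext x
    refine tendsto_nhds_unique (hf' x) ?_
    simp only [hf _ (hTJ _ x)]
    exact tendsto_const_nhds
  · rw [codisjoint_iff, eq_top_iff]
    intro f _
    obtain ⟨g, hg⟩ := exists_limit_functional U hT f
    have hgJ : ∀ x ∈ J, g x = f x := fun x hx => tendsto_nhds_unique (hg x)
      ((f.continuous.tendsto x).comp ((hlim x hx).mono_left hU))
    rw [Submodule.mem_sup]
    refine ⟨f - g, fun x hx => by simp [hgJ x hx], g, fun x => ?_, by simp⟩
    simpa only [hgJ _ (hTJ _ x)] using hg x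
  · intro f hf g hg
    refine le_antisymm (norm_add_le f g) (le_of_forall_pos_le_add fun ε hε => ?_)
    obtain ⟨y, hy, s, hs, hfy⟩ := exists_norm_le_one_ofReal_eq f
      (show ‖f‖ - ε / 4 < ‖f‖ by linarith)
    obtain ⟨x, hx, t, ht, hgx⟩ := exists_norm_le_one_ofReal_eq g
      (show ‖g‖ - ε / 4 < ‖g‖ by linarith)
    have hgx' := hg x
    obtain ⟨l, hl⟩ := (Metric.tendsto_nhds.1 hgx' (ε / 4) (by positivity)).exists
    have hlim : Tendsto (fun k => (f + g) (T l x + (y - T k y))) U (𝓝 (g (T l x) + s)) := by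
      have h := (((hg y).const_sub (g y)).const_add (g (T l x) + f y))
      simpa [hf _ (hTJ _ _), hfy, add_assoc, add_comm, add_left_comm] using h
    have hle : ∀ δ > 0, ‖g (T l x) + s‖ ≤ ‖f + g‖ * (1 + δ) := fun δ hδ =>
      le_of_tendsto hlim.norm <| ((hmax x y hx hy l δ hδ).filter_mono hU).mono fun k hk =>
        ((f + g).le_opNorm _).trans (by gcongr)
    have hle' := hle (ε / (4 * (‖f + g‖ + 1))) (by positivity)
    have h4 : ‖f + g‖ * (1 + ε / (4 * (‖f + g‖ + 1))) ≤ ‖f + g‖ + ε / 4 := by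
      have : ‖f + g‖ * (ε / (4 * (‖f + g‖ + 1))) ≤ ε / 4 := by
        rw [mul_div_assoc', div_le_div_iff₀ (by positivity) (by positivity)]
        nlinarith [norm_nonneg (f + g)]
      linarith
    rw [hgx, dist_eq_norm] at hl
    have h5 : t + s ≤ ‖g (T l x) + s‖ + ε / 4 :=
      calc t + s ≤ ‖((t + s : ℝ) : 𝕜)‖ := by rw [RCLike.norm_ofReal]; exact le_abs_self _
        _ = ‖(g (T l x) + s) - (g (T l x) - t)‖ := by push_cast; congr 1; ring
        _ ≤ _ := (norm_sub_le _ _).trans (by gcongr)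
    linarith

end MIdeal

variable {E : Type*} [NormedAddCommGroup E] [NormedSpace 𝕜 E]

namespace HomPoly

variable {n : ℕ}

theorem continuous (P : HomPoly 𝕜 E n) : Continuous P := by
  obtain ⟨A, hA⟩ := P.2
  rw [show (P : E → 𝕜) = fun x => A fun _ => x from funext hA]
  exact A.cont.comp (continuous_pi fun _ => continuous_id)

theorem norm_apply_le_norm (P : HomPoly 𝕜 E n) {x : E} (hx : ‖x‖ ≤ 1) : ‖P x‖ ≤ ‖P‖ :=
  P.apply_le_supNorm hx

theorem norm_le (P : HomPoly 𝕜 E n) {C : ℝ} (h : ∀ x : E, ‖x‖ ≤ 1 → ‖P x‖ ≤ C) : ‖P‖ ≤ C :=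
  P.supNorm_le h

theorem exists_smul_unit {x : E} {r : ℝ} (hr : 0 < r) (hx : ‖x‖ ≤ r) :
    ∃ y : E, ‖y‖ ≤ 1 ∧ x = (r : 𝕜) • y := by
  have hr' : (r : 𝕜) ≠ 0 := by exact_mod_cast hr.ne'
  refine ⟨(r : 𝕜)⁻¹ • x, ?_, by rw [smul_smul, mul_inv_cancel₀ hr', one_smul]⟩
  rw [norm_smul, norm_inv, RCLike.norm_ofReal, abs_of_pos hr, inv_mul_le_iff₀ hr]
  linarith

theorem norm_apply_le_mul_pow (P : HomPoly 𝕜 E n) {x : E} {r : ℝ} (hr : 0 < r) (hx : ‖x‖ ≤ r) :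
    ‖P x‖ ≤ ‖P‖ * r ^ n := by
  obtain ⟨y, hy, rfl⟩ := exists_smul_unit (𝕜 := 𝕜) hr hx
  rw [map_smul, norm_mul, norm_pow, RCLike.norm_ofReal, abs_of_pos hr, mul_comm]
  gcongr
  exact P.norm_apply_le_norm hy

theorem norm_apply_le_mul_norm_pow (P : HomPoly 𝕜 E n) (x : E) :
    ‖P x‖ ≤ ‖P‖ * ‖x‖ ^ n := by
  have h : Tendsto (fun r : ℝ => ‖P‖ * r ^ n) (𝓝[>] ‖x‖) (𝓝 (‖P‖ * ‖x‖ ^ n)) :=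
    ((by fun_prop : Continuous fun r : ℝ => ‖P‖ * r ^ n).tendsto _).mono_left nhdsWithin_le_nhds
  refine ge_of_tendsto h (eventually_mem_nhdsWithin.mono fun r hr => ?_)
  exact P.norm_apply_le_mul_pow ((norm_nonneg x).trans_lt hr) (Set.mem_Ioi.1 hr).le

/-- The composition `P ∘ S`. -/
def comp (P : HomPoly 𝕜 E n) (S : E →L[𝕜] E) : HomPoly 𝕜 E n :=
  ⟨fun x => P (S x), by
    obtain ⟨A, hA⟩ := P.2
    exact ⟨A.compContinuousLinearMap fun _ => S, fun x => by simp [hA]⟩⟩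

@[simp] theorem comp_apply (P : HomPoly 𝕜 E n) (S : E →L[𝕜] E) (x : E) :
    P.comp S x = P (S x) := rfl

theorem norm_comp_le (P : HomPoly 𝕜 E n) {S : E →L[𝕜] E} (hS : ∀ x, ‖S x‖ ≤ ‖x‖) :
    ‖P.comp S‖ ≤ ‖P‖ :=
  norm_le _ fun x hx => P.norm_apply_le_norm ((hS x).trans hx)

end HomPoly

variable (𝕜 E) in
theorem isClosed_weaklyContinuous (n : ℕ) :
    IsClosed (weaklyContinuous 𝕜 E n : Set (HomPoly 𝕜 E n)) := by
  refine isClosed_of_closure_subset fun P hP B hB => ?_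
  obtain ⟨R, hR0, hR⟩ := hB.exists_pos_norm_le
  refine continuousOn_of_uniform_approx_of_continuousOn fun u hu => ?_
  obtain ⟨ε, hε, hεu⟩ := Metric.mem_uniformity_dist.1 hu
  obtain ⟨Q, hQ, hPQ⟩ := Metric.mem_closure_iff.1 hP (ε / R ^ n) (by positivity)
  refine ⟨_, hQ B hB, ?_⟩
  rintro _ ⟨x, hx, rfl⟩
  apply hεu
  rw [dist_eq_norm] at hPQ ⊢
  calc ‖P x - Q x‖ = ‖(P - Q) x‖ := rfl
    _ ≤ ‖P - Q‖ * R ^ n := (P - Q).norm_apply_le_mul_pow hR0 (hR x hx)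
    _ < ε / R ^ n * R ^ n := by gcongr
    _ = ε := by field_simp

theorem continuous_weakSpace_of_finiteDimensional_range (S : E →L[𝕜] E)
    [FiniteDimensional 𝕜 S.range] :
    Continuous fun z : WeakSpace 𝕜 E => S ((toWeakSpace 𝕜 E).symm z) := by
  let b := Module.finBasis 𝕜 S.range
  let S' : E →L[𝕜] S.range := S.codRestrict S.range fun x => ⟨x, rfl⟩
  have h : (fun z : WeakSpace 𝕜 E => S ((toWeakSpace 𝕜 E).symm z)) = fun z =>
      ∑ i, ((b.coord i).toContinuousLinearMap.comp S') ((toWeakSpace 𝕜 E).symm z) •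
        (b i : E) := by
    funext z
    have := congrArg Subtype.val (b.sum_repr (S' ((toWeakSpace 𝕜 E).symm z)))
    rw [Submodule.coe_sum] at this
    exact this.symm
  rw [h]
  refine continuous_finsetSum _ fun i _ => Continuous.smul ?_ continuous_const
  exact WeakBilin.eval_continuous (topDualPairing 𝕜 E).flip
    ((b.coord i).toContinuousLinearMap.comp S')

theorem HomPoly.comp_mem_weaklyContinuous {n : ℕ} (P : HomPoly 𝕜 E n) (S : E →L[𝕜] E)
    [FiniteDimensional 𝕜 S.range] : P.comp S ∈ weaklyContinuous 𝕜 E n := fun _ _ =>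
  (P.continuous.comp (continuous_weakSpace_of_finiteDimensional_range S)).continuousOn

theorem tendsto_weakSpace {ι : Type*} {l : Filter ι} {v : ι → E} {x : E}
    (h : ∀ γ : StrongDual 𝕜 E, Tendsto (fun k => γ (v k)) l (𝓝 (γ x))) :
    Tendsto (fun k => toWeakSpace 𝕜 E (v k)) l (𝓝 (toWeakSpace 𝕜 E x)) :=
  (WeakBilin.tendsto_iff_forall_eval_tendsto (topDualPairing 𝕜 E).flip (by
    intro x y hxy
    by_contra hne
    obtain ⟨f, hf⟩ := SeparatingDual.exists_separating_of_ne (R := 𝕜) hne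
    exact hf (DFunLike.congr_fun hxy f))).2 h

section FDD

variable {π : ℕ → E →L[𝕜] E}

theorem IsFDD.comp_apply (hπ : IsFDD π) (j k : ℕ) (x : E) : π j (π k x) = π (min j k) x := by
  rw [← hπ.comp j k]; rfl

theorem norm_add_sub_le (hπ : IsFDD π) (hunc : IsOneUnconditional π) {l k : ℕ} (hlk : l ≤ k)
    (x : E) : ‖π l x + (x - π k x)‖ ≤ ‖x‖ := by
  obtain ⟨y, hy, hyx⟩ := hunc (fun j => if l ≤ j ∧ j < k then -1 else 1) x
  have hsum : ∀ N, k ≤ N → ∑ j ∈ Finset.range N,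
      (((if l ≤ j ∧ j < k then (-1 : ℤˣ) else 1 : ℤˣ) : ℤ) : 𝕜) • (π (j + 1) x - π j x) =
      π l x + -(π k x - π l x) + (π N x - π k x) := by
    intro N hN
    rw [← Finset.sum_range_add_sum_Ico _ hN, ← Finset.sum_range_add_sum_Ico _ hlk]
    congr 1
    · congr 1
      · rw [Finset.sum_congr rfl (g := fun j => π (j + 1) x - π j x), Finset.sum_range_sub fun j => π j x]
        · simp [hπ.zero]
        · intro j hj
          have : ¬ (l ≤ j ∧ j < k) := by have := Finset.mem_range.1 hj; omega
          simp [this]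
      · rw [Finset.sum_congr rfl (g := fun j => -(π (j + 1) x - π j x)), Finset.sum_neg_distrib,
          Finset.sum_Ico_sub (fun j => π j x) hlk]
        intro j hj
        simp [Finset.mem_Ico.1 hj]
    · rw [Finset.sum_congr rfl (g := fun j => π (j + 1) x - π j x),
        Finset.sum_Ico_sub (fun j => π j x) hN]
      intro j hj
      have : ¬ (l ≤ j ∧ j < k) := by have := Finset.mem_Ico.1 hj; omega
      simp [this]
  have hy' : y = π l x + -(π k x - π l x) + (x - π k x) := by
    refine tendsto_nhds_unique hy.tendsto_sum_nat ?_
    refine (((hπ.tendsto x).sub_const (π k x)).const_add (π l x + -(π k x - π l x))).congr' ?_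
    filter_upwards [eventually_ge_atTop k] with N hN
    exact (hsum N hN).symm
  have h2 : (2 : 𝕜) • (π l x + (x - π k x)) = x + y := by rw [hy', two_smul]; abel
  have h3 : 2 * ‖π l x + (x - π k x)‖ ≤ ‖x‖ + ‖y‖ := by
    rw [← RCLike.norm_ofNat (K := 𝕜) 2, ← norm_smul]
    simpa [h2] using norm_add_le x y
  linarith

theorem norm_proj_le (hπ : IsFDD π) (hunc : IsOneUnconditional π) (l : ℕ) (x : E) :
    ‖π l x‖ ≤ ‖x‖ := by
  have h : Tendsto (fun k => ‖π l x + (x - π k x)‖) atTop (𝓝 ‖π l x‖) := by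
    simpa using (((hπ.tendsto x).const_sub x).const_add (π l x)).norm
  refine le_of_tendsto h ?_
  filter_upwards [eventually_ge_atTop l] with k hk
  exact norm_add_sub_le hπ hunc hk x

theorem norm_sub_proj_le (hπ : IsFDD π) (hunc : IsOneUnconditional π) (k : ℕ) (x : E) :
    ‖x - π k x‖ ≤ ‖x‖ := by
  simpa [hπ.zero] using norm_add_sub_le hπ hunc k.zero_le x

variable {m : ℕ → ℕ}

theorem blockProj_proj_of_le (hπ : IsFDD π) (hm : StrictMono m) {i j : ℕ} (hij : i ≤ j) (x : E) :
    blockProj π m i (π (m j) x) = blockProj π m i x := by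
  cases i with
  | zero => simp [blockProj, hπ.comp_apply, min_eq_left (hm.monotone hij)]
  | succ i =>
    simp [blockProj, hπ.comp_apply, min_eq_left (hm.monotone hij),
      min_eq_left (hm.monotone (Nat.le_of_succ_le hij))]

theorem blockProj_proj_of_lt (hπ : IsFDD π) (hm : StrictMono m) {i j : ℕ} (hij : j < i) (x : E) :
    blockProj π m i (π (m j) x) = 0 := by
  cases i with
  | zero => omega
  | succ i =>
    simp [blockProj, hπ.comp_apply, min_eq_right (hm.monotone hij.le),
      min_eq_right (hm.monotone (Nat.le_of_lt_succ hij))]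

theorem proj_blockProj (hπ : IsFDD π) (i k : ℕ) (x : E) :
    π k (blockProj π m i x) = blockProj π m i (π k x) := by
  cases i <;> simp [blockProj, hπ.comp_apply, min_comm]

variable {n : ℕ} {P Q : HomPoly 𝕜 E n}

theorem apply_zero_of_mem_blockDiagonal (hQ : Q ∈ blockDiagonal π m n) : Q 0 = 0 := by
  have h : Tendsto (fun N => ∑ j ∈ Finset.range N, Q (blockProj π m j 0)) atTop (𝓝 (Q 0)) := hQ 0
  have h' := ((tendsto_add_atTop_iff_nat 1).2 h).sub h
  simp only [Finset.sum_range_succ, add_sub_cancel_left, _root_.map_zero, sub_self] at h'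
  exact tendsto_nhds_unique tendsto_const_nhds h'

theorem apply_eq_add_of_mem_blockDiagonal (hπ : IsFDD π) (hm : StrictMono m)
    (hQ : Q ∈ blockDiagonal π m n) (j : ℕ) (x : E) :
    Q x = Q (π (m j) x) + Q (x - π (m j) x) := by
  refine tendsto_nhds_unique (hQ x) (((hQ (π (m j) x)).add (hQ (x - π (m j) x))).congr fun N => ?_)
  rw [← Finset.sum_add_distrib]
  refine Finset.sum_congr rfl fun i _ => ?_
  rw [_root_.map_sub]
  rcases le_or_gt i j with h | h
  · simp [blockProj_proj_of_le hπ hm h, apply_zero_of_mem_blockDiagonal hQ]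
  · simp [blockProj_proj_of_lt hπ hm h, apply_zero_of_mem_blockDiagonal hQ]

theorem comp_mem_blockDiagonal (hπ : IsFDD π) (hP : P ∈ blockDiagonal π m n) (k : ℕ) :
    P.comp (π k) ∈ blockDiagonal π m n := fun x => by
  simpa [proj_blockProj hπ] using hP (π k x)

theorem tendsto_dual_sub_proj (hshr : IsShrinking π) (hm : StrictMono m) {l : Filter ℕ}
    (hl : l ≤ atTop) {x : ℕ → E} (hx : ∀ᶠ k in l, ‖x k‖ ≤ 1) (γ : StrongDual 𝕜 E) :
    Tendsto (fun k => γ (x k - π (m k) (x k))) l (𝓝 0) := by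
  have h : Tendsto (fun k => ‖γ - γ.comp (π (m k))‖) l (𝓝 0) := by
    simpa using (((hshr γ).comp hm.tendsto_atTop).const_sub γ).norm.mono_left hl
  refine squeeze_zero_norm' ?_ h
  filter_upwards [hx] with k hk
  calc ‖γ (x k - π (m k) (x k))‖ = ‖(γ - γ.comp (π (m k))) (x k)‖ := by simp
    _ ≤ ‖γ - γ.comp (π (m k))‖ := (γ - γ.comp (π (m k))).unit_le_opNorm _ hk

/-- If `x` is a limit point of the heads of vectors of the unit ball whose tails tend weakly to
zero, then property (M) allows to replace `x` by any shorter vector. -/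
theorem PropertyM.eventually_norm_add_lt (hM : PropertyM 𝕜 E) {ι : Type*} {l : Filter ι} [l.NeBot]
    {y v : ι → E} {u w : E} (hy : Tendsto y l (𝓝 u))
    (hv : ∀ γ : StrongDual 𝕜 E, Tendsto (fun k => γ (v k)) l (𝓝 0))
    (hyv : ∀ᶠ k in l, ‖y k + v k‖ ≤ 1) (hw : ‖w‖ ≤ ‖u‖) {r : ℝ} (hr : 1 < r) :
    ∀ᶠ k in l, ‖w + v k‖ < r := by
  have hu : ∀ δ > 0, ∀ᶠ k in l, ‖u + v k‖ ≤ 1 + δ := fun δ hδ => by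
    filter_upwards [hyv, Metric.tendsto_nhds.1 hy δ hδ] with k h1 h2
    rw [dist_eq_norm'] at h2
    calc ‖u + v k‖ = ‖(u - y k) + (y k + v k)‖ := by congr 1; abel
      _ ≤ 1 + δ := (norm_add_le _ _).trans (by linarith)
  have hvb : ∀ᶠ k in l, ‖v k‖ ≤ ‖u‖ + 2 := (hu 1 one_pos).mono fun k hk => by
    have := norm_sub_le (u + v k) u
    rw [add_sub_cancel_left] at this
    linarith
  have hlim := hM w u hw (map v l) inferInstance ⟨‖u‖ + 2, hvb⟩ fun γ => hv γ
  have hle : limsup (fun x => ‖u + x‖) (map v l) ≤ 1 :=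
    le_of_forall_pos_le_add fun δ hδ => limsup_le_of_le
      (isCoboundedUnder_le_of_le _ (x := 0) fun _ => norm_nonneg _) (hu δ hδ)
  refine eventually_map.1 (eventually_lt_of_limsup_lt (f := map v l) (u := fun x => ‖w + x‖)
    (hlim.trans_lt (hle.trans_lt hr)) ?_)
  refine isBoundedUnder_of_eventually_le (a := ‖w‖ + (‖u‖ + 2)) (hvb.mono fun k hk => ?_)
  exact (norm_add_le _ _).trans (by gcongr)

theorem tendsto_proj_comp (hπ : IsFDD π) (hm : StrictMono m) (x : E) :
    Tendsto (fun j => π (m j) x) atTop (𝓝 x) := (hπ.tendsto x).comp hm.tendsto_atTop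

theorem apply_proj_add_sub (hπ : IsFDD π) (hm : StrictMono m) (hQ : Q ∈ blockDiagonal π m n)
    {j k : ℕ} (hjk : j ≤ k) (w x : E) :
    Q (π (m j) w + (x - π (m k) x)) = Q (π (m j) w) + Q (x - π (m k) x) := by
  rw [apply_eq_add_of_mem_blockDiagonal hπ hm hQ j]
  simp [hπ.comp_apply, min_eq_left (hm.monotone hjk)]

/-- The limit of `Q` along a weakly null sequence of tails is controlled by the norm of the limit of
the corresponding heads. -/
theorem norm_limit_tail_le (hπ : IsFDD π) (hunc : IsOneUnconditional π) (hshr : IsShrinking π)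
    (hm : StrictMono m) (hM : PropertyM 𝕜 E) (hQ : Q ∈ blockDiagonal π m n) (hQ1 : ‖Q‖ ≤ 1)
    {l : Filter ℕ} [l.NeBot] (hl : l ≤ atTop) {x y : ℕ → E} {u : E} {q : 𝕜}
    (hx : ∀ᶠ k in l, ‖x k‖ ≤ 1) (hy : Tendsto y l (𝓝 u)) (hu : ‖u‖ ≤ 1)
    (hyx : ∀ᶠ k in l, ‖y k + (x k - π (m k) (x k))‖ ≤ 1)
    (hq : Tendsto (fun k => Q (x k - π (m k) (x k))) l (𝓝 q)) :
    ‖u‖ ^ n + ‖q‖ ≤ 1 := by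
  obtain ⟨c, hc, hcq⟩ := RCLike.exists_norm_eq_mul_self q
  let B := Metric.closedBall (0 : E) 1
  have : Nonempty B := ⟨⟨0, by simp [B]⟩⟩
  have hre : ∀ w : E, ‖w‖ ≤ 1 → RCLike.re (c * Q w) ≤ 1 := fun w hw =>
    (RCLike.re_le_norm _).trans (by
      rw [norm_mul, hc, one_mul]; exact (Q.norm_apply_le_norm hw).trans hQ1)
  let M : ℝ := ⨆ w : B, RCLike.re (c * Q w)
  have hbdd : BddAbove (Set.range fun w : B => RCLike.re (c * Q w)) :=
    ⟨1, by rintro _ ⟨w, rfl⟩; exact hre w (mem_closedBall_zero_iff.1 w.2)⟩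
  have hM1 : M ≤ 1 := ciSup_le fun w => hre w (mem_closedBall_zero_iff.1 w.2)
  have hMw : ∀ w : E, ‖w‖ ≤ 1 → RCLike.re (c * Q w) ≤ M := fun w hw =>
    le_ciSup hbdd ⟨w, mem_closedBall_zero_iff.2 hw⟩
  have hsmul : ∀ (r : ℝ) (w : E), RCLike.re (c * Q ((r : 𝕜) • w)) = r ^ n * RCLike.re (c * Q w) :=
    fun r w => by
      rw [Q.map_smul, mul_left_comm, ← RCLike.ofReal_pow, RCLike.re_ofReal_mul]
  have hMr : ∀ (r : ℝ) (z : E), 0 < r → ‖z‖ ≤ r → RCLike.re (c * Q z) ≤ r ^ n * M :=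
    fun r z hr hz => by
      obtain ⟨w, hw, rfl⟩ := HomPoly.exists_smul_unit (𝕜 := 𝕜) hr hz
      rw [hsmul]
      gcongr
      exact hMw w hw
  have hfin : ∀ (j : ℕ) (w : E), ‖w‖ ≤ ‖u‖ → RCLike.re (c * Q (π (m j) w)) + ‖q‖ ≤ M := by
    intro j w hw
    have hlim : Tendsto (fun k => RCLike.re (c * Q (π (m j) w + (x k - π (m k) (x k))))) l
        (𝓝 (RCLike.re (c * Q (π (m j) w)) + ‖q‖)) := by
      have h := (RCLike.continuous_re.tendsto _).comp ((hq.const_add (Q (π (m j) w))).const_mul c)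
      rw [mul_add, ← hcq, _root_.map_add, RCLike.ofReal_re] at h
      refine h.congr' ?_
      filter_upwards [hl (eventually_ge_atTop j)] with k hk
      simp [apply_proj_add_sub hπ hm hQ hk]
    have hr : ∀ r : ℝ, 1 < r → RCLike.re (c * Q (π (m j) w)) + ‖q‖ ≤ r ^ n * M := fun r hr =>
      le_of_tendsto hlim <| (hM.eventually_norm_add_lt hy
        (tendsto_dual_sub_proj hshr hm hl hx) hyx ((norm_proj_le hπ hunc (m j) w).trans hw)
        hr).mono fun k hk => hMr r _ (by linarith) hk.le
    have hr1 : Tendsto (fun r : ℝ => r ^ n * M) (𝓝[>] 1) (𝓝 M) := by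
      have : Continuous fun r : ℝ => r ^ n * M := by fun_prop
      simpa using (this.tendsto 1).mono_left nhdsWithin_le_nhds
    exact ge_of_tendsto hr1 (eventually_mem_nhdsWithin.mono fun r => hr r)
  have hall : ∀ w : E, ‖w‖ ≤ ‖u‖ → RCLike.re (c * Q w) + ‖q‖ ≤ M := fun w hw => by
    have h : Continuous fun z : E => RCLike.re (c * Q z) + ‖q‖ :=
      (RCLike.continuous_re.comp (Q.continuous.const_mul c)).add_const _
    exact le_of_tendsto ((h.tendsto w).comp (tendsto_proj_comp hπ hm w))
      (Eventually.of_forall fun j => hfin j w hw)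
  have hball : ∀ w : E, ‖w‖ ≤ 1 → ‖u‖ ^ n * RCLike.re (c * Q w) ≤ M - ‖q‖ := fun w hw => by
    have := hall ((‖u‖ : 𝕜) • w) (by
      rw [norm_smul, RCLike.norm_ofReal, abs_norm]
      exact mul_le_of_le_one_right (norm_nonneg u) hw)
    rw [hsmul] at this
    linarith
  have hkey : ‖u‖ ^ n * M ≤ M - ‖q‖ := by
    rw [Real.mul_iSup_of_nonneg (by positivity)]
    exact ciSup_le fun w => hball w (mem_closedBall_zero_iff.1 w.2)
  have hun : ‖u‖ ^ n ≤ 1 := pow_le_one₀ (norm_nonneg u) hu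
  nlinarith

theorem eventually_norm_head_add_norm_tail_le (hπ : IsFDD π) (hunc : IsOneUnconditional π)
    (hshr : IsShrinking π) (hm : StrictMono m) (hM : PropertyM 𝕜 E) (hP1 : ‖P‖ ≤ 1)
    (hQ : Q ∈ blockDiagonal π m n) (hQ1 : ‖Q‖ ≤ 1) (l : ℕ) {ε : ℝ} (hε : 0 < ε) :
    ∀ᶠ k in atTop, ∀ x : E, ‖x‖ ≤ 1 →
      ‖P (π (m l) x)‖ + ‖Q (x - π (m k) x)‖ ≤ 1 + ε := by
  by_contra hcon
  let S : Set ℕ := {k | ∃ x : E, ‖x‖ ≤ 1 ∧ 1 + ε < ‖P (π (m l) x)‖ + ‖Q (x - π (m k) x)‖}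
  have hfreq : ∃ᶠ k in atTop, k ∈ S := by
    simpa only [Filter.Frequently, S, Set.mem_ofPred_eq, not_exists, not_and, not_lt] using hcon
  choose! x hx hxε using fun k (hk : k ∈ S) => hk
  have : (atTop ⊓ 𝓟 S).NeBot := frequently_mem_iff_neBot.1 hfreq
  let U := Ultrafilter.of (atTop ⊓ 𝓟 S)
  have hUle : (U : Filter ℕ) ≤ atTop ⊓ 𝓟 S := Ultrafilter.of_le _
  have hUtop : (U : Filter ℕ) ≤ atTop := hUle.trans inf_le_left
  have hUbad : S ∈ (U : Filter ℕ) := le_principal_iff.1 (hUle.trans inf_le_right)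
  have hx1 : ∀ᶠ k in U, ‖x k‖ ≤ 1 := mem_of_superset hUbad fun k => hx k
  have hfd := hπ.finiteDimensional_range (m l)
  have hproper : ProperSpace (π (m l)).range := FiniteDimensional.proper_rclike 𝕜 _
  obtain ⟨u, hu⟩ := exists_tendsto_of_bounded U (y := 0) (C := 1)
    (f := fun k => (⟨π (m l) (x k), ⟨x k, rfl⟩⟩ : (π (m l)).range))
    (hx1.mono fun k hk => by
      rw [dist_zero_right]
      exact (norm_proj_le hπ hunc (m l) (x k)).trans hk)
  replace hu : Tendsto (fun k => π (m l) (x k)) U (𝓝 (u : E)) :=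
    (continuous_subtype_val.tendsto u).comp hu
  have htail : ∀ᶠ k in U, ‖x k - π (m k) (x k)‖ ≤ 1 :=
    hx1.mono fun k hk => (norm_sub_proj_le hπ hunc (m k) (x k)).trans hk
  obtain ⟨q, hq⟩ := exists_tendsto_of_bounded U (y := 0) (C := 1)
    (f := fun k => Q (x k - π (m k) (x k)))
    (htail.mono fun k hk => by
      rw [dist_zero_right]; exact (Q.norm_apply_le_norm hk).trans hQ1)
  have hu1 : ‖(u : E)‖ ≤ 1 := le_of_tendsto hu.norm
    (hx1.mono fun k hk => (norm_proj_le hπ hunc (m l) (x k)).trans hk)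
  have hle := norm_limit_tail_le hπ hunc hshr hm hM hQ hQ1 hUtop hx1 hu hu1
    (by
      filter_upwards [hx1, hUtop (eventually_ge_atTop l)] with k hk hlk
      exact (norm_add_sub_le hπ hunc (hm.monotone hlk) (x k)).trans hk) hq
  have hge : 1 + ε ≤ ‖P u‖ + ‖q‖ :=
    ge_of_tendsto (((P.continuous.tendsto _).comp hu).norm.add hq.norm)
      (mem_of_superset hUbad fun k hk => (hxε k hk).le)
  have hPu : ‖P u‖ ≤ ‖(u : E)‖ ^ n := (P.norm_apply_le_mul_norm_pow u).trans
    (mul_le_of_le_one_left (by positivity) hP1)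
  linarith

theorem eventually_norm_comp_add_sub_comp_le (hπ : IsFDD π) (hunc : IsOneUnconditional π)
    (hshr : IsShrinking π) (hm : StrictMono m) (hM : PropertyM 𝕜 E) (hP1 : ‖P‖ ≤ 1)
    (hQ : Q ∈ blockDiagonal π m n) (hQ1 : ‖Q‖ ≤ 1) (l : ℕ) {ε : ℝ} (hε : 0 < ε) :
    ∀ᶠ k in atTop, ‖P.comp (π (m l)) + (Q - Q.comp (π (m k)))‖ ≤ 1 + ε := by
  filter_upwards [eventually_norm_head_add_norm_tail_le hπ hunc hshr hm hM hP1 hQ hQ1 l hε]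
    with k hk
  refine HomPoly.norm_le _ fun x hx => ?_
  simp only [HomPoly.add_apply, HomPoly.sub_apply, HomPoly.comp_apply]
  rw [apply_eq_add_of_mem_blockDiagonal hπ hm hQ k x, add_sub_cancel_left]
  exact (norm_add_le _ _).trans (hk x hx)

theorem tendsto_comp_proj_of_mem_blockDiagonalW (hπ : IsFDD π) (hunc : IsOneUnconditional π)
    (hshr : IsShrinking π) (hm : StrictMono m) (hP : P ∈ blockDiagonalW π m n) :
    Tendsto (fun k => P.comp (π (m k))) atTop (𝓝 P) := by
  obtain ⟨hPd, hPw⟩ := hP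
  rw [Metric.tendsto_nhds]
  intro ε hε
  suffices h : ∀ᶠ k in atTop, ∀ x : E, ‖x‖ ≤ 1 → ‖P (x - π (m k) x)‖ ≤ ε / 2 by
    filter_upwards [h] with k hk
    rw [dist_eq_norm']
    refine (HomPoly.norm_le _ fun x hx => ?_).trans_lt (half_lt_self hε)
    rw [HomPoly.sub_apply, HomPoly.comp_apply, apply_eq_add_of_mem_blockDiagonal hπ hm hPd k x,
      add_sub_cancel_left]
    exact hk x hx
  have hex : ∀ k, ∃ x : E, ‖x‖ ≤ 1 ∧ (ε / 2 < ‖P (x - π (m k) x)‖ ∨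
      ∀ x : E, ‖x‖ ≤ 1 → ‖P (x - π (m k) x)‖ ≤ ε / 2) := fun k => by
    by_cases h : ∀ x : E, ‖x‖ ≤ 1 → ‖P (x - π (m k) x)‖ ≤ ε / 2
    · exact ⟨0, by simp, Or.inr h⟩
    · push Not at h
      obtain ⟨x, hx, hxε⟩ := h
      exact ⟨x, hx, Or.inl hxε⟩
  choose x hx hxε using hex
  have hweak : Tendsto (fun k => toWeakSpace 𝕜 E (x k - π (m k) (x k))) atTop
      (𝓝 (toWeakSpace 𝕜 E 0)) := tendsto_weakSpace fun γ => by
    simpa using tendsto_dual_sub_proj hshr hm le_rfl (Eventually.of_forall hx) γ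
  have hcont := hPw (Metric.closedBall 0 1) Metric.isBounded_closedBall (toWeakSpace 𝕜 E 0)
    ⟨0, by simp, rfl⟩
  have hlim := hcont.tendsto.comp (tendsto_nhdsWithin_iff.2 ⟨hweak, Eventually.of_forall fun k =>
    ⟨_, mem_closedBall_zero_iff.2 ((norm_sub_proj_le hπ hunc (m k) (x k)).trans (hx k)), rfl⟩⟩)
  simp only [Function.comp_def, LinearEquiv.symm_apply_apply,
    apply_zero_of_mem_blockDiagonal hPd] at hlim
  filter_upwards [Metric.tendsto_nhds.1 hlim (ε / 2) (by positivity)] with k hk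
  rw [dist_zero_right] at hk
  exact (hxε k).resolve_left hk.not_gt

/-- The operator `P ↦ P ∘ π k` on `D_J(ⁿE)`. -/
noncomputable def compProj (hπ : IsFDD π) (hunc : IsOneUnconditional π) (m : ℕ → ℕ) (n k : ℕ) :
    blockDiagonal π m n →L[𝕜] blockDiagonal π m n :=
  LinearMap.mkContinuous
    { toFun := fun P => ⟨P.1.comp (π k), comp_mem_blockDiagonal hπ P.2 k⟩
      map_add' := fun _ _ => rfl
      map_smul' := fun _ _ => rfl } 1
    fun P => by
      rw [one_mul]
      exact P.1.norm_comp_le (norm_proj_le hπ hunc k)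

end FDD

end PolyMIdeal

open PolyMIdeal
theorem theorem4p8 {𝕜 : Type*} [RCLike 𝕜] {E : Type*} [NormedAddCommGroup E] [NormedSpace 𝕜 E]
    [CompleteSpace E] (π : ℕ → E →L[𝕜] E) (hπ : IsFDD π) (hunc : IsOneUnconditional π)
    (hshr : IsShrinking π) (m : ℕ → ℕ) (hm : StrictMono m) (hpos : ∀ j, 0 < m j)
    (hM : PropertyM 𝕜 E) (n : ℕ) :
    IsMIdeal ((blockDiagonalW π m n).submoduleOf (blockDiagonal π m n)) := by
  refine isMIdeal_of_contractions (T := fun k => compProj hπ hunc m n (m k)) ?_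
    (fun k P => P.1.norm_comp_le (norm_proj_le hπ hunc (m k))) (fun k P => ?_) (fun P hP => ?_)
    (fun P Q hP hQ l ε hε => ?_)
  · rw [show (((blockDiagonalW π m n).submoduleOf (blockDiagonal π m n) :
        Submodule 𝕜 (blockDiagonal π m n)) : Set (blockDiagonal π m n)) =
        Subtype.val ⁻¹' (weaklyContinuous 𝕜 E n : Set (HomPoly 𝕜 E n)) from
      Set.ext fun P => ⟨fun h => h.2, fun h => ⟨P.2, h⟩⟩]
    exact (isClosed_weaklyContinuous 𝕜 E n).preimage continuous_subtype_val
  · have := hπ.finiteDimensional_range (m k)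
    exact ⟨comp_mem_blockDiagonal hπ P.2 (m k), P.1.comp_mem_weaklyContinuous (π (m k))⟩
  · exact tendsto_subtype_rng.2 (tendsto_comp_proj_of_mem_blockDiagonalW hπ hunc hshr hm hP)
  · exact eventually_norm_comp_add_sub_comp_le hπ hunc hshr hm hM hP Q.2 hQ l hε
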